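/- Let $q$ be a positive $C^1$ probability density on $\mathbb{R}^n$ with distribution $Q$, and let $\Sigma$ be a $C^1$ function on $\mathbb{R}^n$ whose values are symmetric positive definite $n\times n$ matrices. Let $L^2=L^2(Q)$ with inner product $\langle\cdot,\cdot\rangle$. Let $\mathcal{D}(f)$ be the set of $\phi\in L^2$ that have a weak derivative $\nabla\phi=g$, i.e. for which there is a measurable $g:\mathbb{R}^n\to\mathbb{R}^n$ with $\int g'\Sigma g\,q\,dx<\infty$ and $\int\phi\,\nabla\psi\,dx=-\int g\,\psi\,dx$ for every $C^1$ function $\psi$ with compact support, and for $\phi,\psi\in\mathcal{D}(f)$ put $f(\phi,\psi)=\frac12\int(\nabla\phi)'\Sigma(\nabla\psi)\,q\,dx$. Write $q^{1/2}=\exp(-h)$. Assume that $h$ is $C^2$ and that the space $C_K^2$ of $C^2$ functions with compact support is a core of $f$, i.e. $C_K^2\subset\mathcal{D}(f)$ and for every $\phi_0\in\mathcal{D}(f)$ there are $\phi_j\in C_K^2$ with $\langle\phi_j-\phi_0,\phi_j-\phi_0\rangle+f(\phi_j-\phi_0,\phi_j-\phi_0)\to0$. Suppose that there are a $C^2$ function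 $v:\mathbb{R}^n\to\mathbb{R}$ and a constant $\underline{c}>0$ such that, with $\varsigma=\exp(v)$, $$\Sigma(x)\ge\varsigma(x)^2I\ge\underline{c}\,I\quad\text{for all }x$$ in the sense of positive semidefinite matrices, and such that $$\lim_{|x|\to\infty}\Big[|\nabla v(x)|^2-\mathrm{tr}\,\nabla^2v(x)\Big]=0,$$ $$\lim_{|x|\to\infty}\Big[\varsigma(x)^2\,\mathrm{tr}\big(\nabla^2v(x)-\nabla^2h(x)\big)+\varsigma(x)^2|\nabla h(x)-\nabla v(x)|^2\Big]=+\infty.$$ Then for every $\theta>0$ the set $\{\phi\in\mathcal{D}(f): f(\phi,\phi)+\theta\langle\phi,\phi\rangle\le1\}$ is precompact (has compact closure) in $L^2$. -/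

import Mathlib

open MeasureTheory Filter Topology

noncomputable section

namespace NPC

/-- The state space `ℝⁿ` with its Euclidean norm. -/
abbrev E (n : ℕ) : Type := EuclideanSpace ℝ (Fin n)

/-- `q` is a positive, continuously differentiable probability density on `ℝⁿ`. -/
structure IsC1Density {n : ℕ} (q : E n → ℝ) : Prop where
  pos : ∀ x, 0 < q x
  contDiff : ContDiff ℝ 1 q
  integrable : Integrable q
  integral_eq_one : ∫ x, q x = 1

/-- `S` is a continuously differentiable (symmetric) positive definite matrix function on `ℝⁿ`. -/
structure IsC1Penalty {n : ℕ} (S : E n → Matrix (Fin n) (Fin n) ℝ) : Prop where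
  posDef : ∀ x, (S x).PosDef
  contDiff : ∀ i j, ContDiff ℝ 1 fun x => S x i j

/-- The probability distribution `Q` with Lebesgue density `q`. -/
abbrev law {n : ℕ} (q : E n → ℝ) : Measure (E n) :=
  volume.withDensity fun x => ENNReal.ofReal (q x)

/-- The space `L²` of square integrable functions with respect to `Q`. -/
abbrev L2 {n : ℕ} (q : E n → ℝ) : Type := Lp ℝ 2 (law q)

/-- The bilinear expression `a' M b`. -/
def bilin {n : ℕ} (M : Matrix (Fin n) (Fin n) ℝ) (a b : E n) : ℝ :=
  a.ofLp ⬝ᵥ M.mulVec b.ofLp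

/-- `g` is a weak derivative of `φ` with finite energy: `g` is measurable, `∫ g' S g q < ∞`, and
`∫ φ ∇ψ = - ∫ g ψ` for all `C¹` functions `ψ` with compact support. (For positive continuous `q`
and positive definite continuous `S`, both `φ` and `g` are locally square integrable, so that
the last two integrals converge.) -/
structure IsWeakGradient {n : ℕ} (q : E n → ℝ) (S : E n → Matrix (Fin n) (Fin n) ℝ)
    (φ : L2 q) (g : E n → E n) : Prop where
  measurable : Measurable g
  energy_finite : Integrable fun x => bilin (S x) (g x) (g x) * q x
  integral_eq : ∀ ψ : E n → ℝ, ContDiff ℝ 1 ψ → HasCompactSupport ψ →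
    ∫ x, φ x • gradient ψ x = - ∫ x, ψ x • g x

/-- The domain `𝓓(f)`: the weighted Sobolev space of all `φ ∈ L²` with a weak derivative of
finite energy. -/
def formDomain {n : ℕ} (q : E n → ℝ) (S : E n → Matrix (Fin n) (Fin n) ℝ) : Set (L2 q) :=
  {φ | ∃ g, IsWeakGradient q S φ g}

open Classical in
/-- The weak derivative of `φ ∈ 𝓓(f)`, which is unique up to a null set. -/
def weakGradient {n : ℕ} (q : E n → ℝ) (S : E n → Matrix (Fin n) (Fin n) ℝ) (φ : L2 q) :
    E n → E n :=
  if hφ : ∃ g, IsWeakGradient q S φ g then hφ.choose else 0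

/-- The form `f(φ, ψ) = (1/2) ∫ (∇φ)' S (∇ψ) q` for `φ, ψ ∈ 𝓓(f)`. -/
def form {n : ℕ} (q : E n → ℝ) (S : E n → Matrix (Fin n) (Fin n) ℝ) (φ ψ : L2 q) : ℝ :=
  (1 / 2) * ∫ x, bilin (S x) (weakGradient q S φ x) (weakGradient q S ψ x) * q x

/-- The (classes in `L²` of) twice continuously differentiable functions with compact support. -/
def CK2 {n : ℕ} (q : E n → ℝ) : Set (L2 q) :=
  {φ | ∃ u : E n → ℝ, ContDiff ℝ 2 u ∧ HasCompactSupport u ∧ φ =ᵐ[law q] u}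

/-- The family `C ⊆ 𝓓(f)` is a core of `f`: every `φ₀ ∈ 𝓓(f)` is the limit of a sequence in `C`
with respect to `⟨φ, φ⟩ + f(φ, φ)`. -/
def IsCore {n : ℕ} (q : E n → ℝ) (S : E n → Matrix (Fin n) (Fin n) ℝ) (C : Set (L2 q)) : Prop :=
  C ⊆ formDomain q S ∧
    ∀ φ₀ ∈ formDomain q S, ∃ φ : ℕ → L2 q, (∀ j, φ j ∈ C) ∧
      Tendsto (fun j => inner ℝ (φ j - φ₀) (φ j - φ₀) + form q S (φ j - φ₀) (φ j - φ₀))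
        atTop (𝓝 0)

/-- The function `h` with `q^{1/2} = exp (-h)`. -/
def logPotential {n : ℕ} (q : E n → ℝ) (x : E n) : ℝ := -Real.log (Real.sqrt (q x))

/-- The matrix of second partial derivatives `∂²u / ∂xᵢ ∂xⱼ` at `x`. -/
def hessian {n : ℕ} (u : E n → ℝ) (x : E n) : Matrix (Fin n) (Fin n) ℝ :=
  Matrix.of fun i j =>
    fderiv ℝ (fun y => fderiv ℝ u y (EuclideanSpace.single j 1)) x (EuclideanSpace.single i 1)

/-- The tail criterion, for `ς = exp v` with `v` twice continuously differentiable: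
`S(x) ≥ ς(x)² I ≥ c I` for some `c > 0`, together with the two limits as `|x| → ∞`. -/
structure TailCriterion {n : ℕ} (q : E n → ℝ) (S : E n → Matrix (Fin n) (Fin n) ℝ)
    (v : E n → ℝ) : Prop where
  contDiff : ContDiff ℝ 2 v
  le_penalty : ∀ x, (S x - (Real.exp (v x) ^ 2) • (1 : Matrix (Fin n) (Fin n) ℝ)).PosSemidef
  lower_bound : ∃ c : ℝ, 0 < c ∧ ∀ x, c ≤ Real.exp (v x) ^ 2
  tail_growth : Tendsto
    (fun x => inner ℝ (gradient v x) (gradient v x) - (hessian v x).trace)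
    (cocompact (E n)) (𝓝 0)
  tail_diverge : Tendsto
    (fun x => Real.exp (v x) ^ 2 * (hessian v x - hessian (logPotential q) x).trace
      + Real.exp (v x) ^ 2 * ‖gradient (logPotential q) x - gradient v x‖ ^ 2)
    (cocompact (E n)) atTop

/-- The compactness condition: `{φ ∈ 𝓓(f) : f(φ, φ) + θ ⟨φ, φ⟩ ≤ 1}` is precompact in `L²`. -/
def ExistenceCondition {n : ℕ} (q : E n → ℝ) (S : E n → Matrix (Fin n) (Fin n) ℝ) (θ : ℝ) : Prop :=
  IsCompact (closure {φ : L2 q | φ ∈ formDomain q S ∧ form q S φ φ + θ * inner ℝ φ φ ≤ 1})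

end NPC

end

noncomputable section

namespace NPC

/-! The proof is a ground state argument combined with a Rellich-type compactness argument. Put `p =
v - h`, so that `exp (2p) = ς² q`. For compactly supported `u`, expanding `0 ≤ ∫ exp (2p) |∇u + u
∇p|²` and integrating the cross term by parts gives `∫ exp (2p) (Δp + |∇p|²) u² ≤ ∫ exp (2p) |∇u|²`.
The left side is `∫ V u² q` with `V = tailPotential q v`, and the right side is at most `2 f(u, u)`
because `Σ ≥ ς² I` (`integral_tailPotential_le`, `integral_weighted_gradient_sq_le_form`). Since `V`
tends to infinity and is bounded below, functions of bounded norm and energy have uniformly small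
`L²` mass outside a large ball (`exists_setIntegral_compl_ball_le`).

Inside the ball, `q` and `ς²` are bounded below, so the energy controls the Lebesgue Dirichlet
integral. Cutting the ball into small convex pieces and applying a Poincaré inequality on each
bounds the `L²` norm by a small error plus finitely many integrals over pieces
(`exists_finset_setIntegral_ball_le`).

Hence finitely many continuous functionals separate the points of a `C²` energy ball up to any `ε`,
so the energy ball is totally bounded (`totallyBounded_energyBall`). The core property places the
sublevel set of the form in its closure (`sublevel_subset_closure_energyBall`), and completeness of
`L²` turns total boundedness into compactness. -/

lemma lintegral_lintegral_lintegral_rotate {α β : Type*} [MeasurableSpace α] [MeasurableSpace β]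
    (μ : Measure α) (ν : Measure β) [SFinite μ] [SFinite ν] {G : (α × α) × β → ENNReal}
    (hG : Measurable G) :
    ∫⁻ x, ∫⁻ y, ∫⁻ t, G ((x, y), t) ∂ν ∂μ ∂μ = ∫⁻ t, ∫⁻ x, ∫⁻ y, G ((x, y), t) ∂μ ∂μ ∂ν := by
  have h1 : Measurable fun p : α × β => ∫⁻ y, G ((p.1, y), p.2) ∂μ :=
    Measurable.lintegral_prod_right' (f := fun r : (α × β) × α => G ((r.1.1, r.2), r.1.2))
      (by fun_prop)
  have h2 : ∀ x, ∫⁻ y, ∫⁻ t, G ((x, y), t) ∂ν ∂μ = ∫⁻ t, ∫⁻ y, G ((x, y), t) ∂μ ∂ν := fun x =>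
    lintegral_lintegral_swap (f := fun y t => G ((x, y), t)) (by fun_prop)
  simp_rw [h2]
  exact lintegral_lintegral_swap (f := fun x t => ∫⁻ y, G ((x, y), t) ∂μ) h1.aemeasurable

lemma lintegral_lintegral_const_mul_lintegral {α β : Type*} [MeasurableSpace α]
    [MeasurableSpace β] (μ : Measure α) (ν : Measure β) [SFinite μ] [SFinite ν] (c : ENNReal)
    {G : (α × α) × β → ENNReal} (hG : Measurable G) :
    ∫⁻ x, ∫⁻ y, (c * ∫⁻ t, G ((x, y), t) ∂ν) ∂μ ∂μ
      = c * ∫⁻ t, ∫⁻ x, ∫⁻ y, G ((x, y), t) ∂μ ∂μ ∂ν := by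
  have hm : Measurable fun p : α × α => ∫⁻ t, G (p, t) ∂ν := hG.lintegral_prod_right'
  rw [← lintegral_lintegral_lintegral_rotate μ ν hG,
    ← lintegral_const_mul _ hm.lintegral_prod_right']
  exact lintegral_congr fun x => lintegral_const_mul _ (hm.comp measurable_prodMk_left)

/-! ### Poincaré inequality on bounded convex sets -/

section Poincare

variable {F : Type*} [NormedAddCommGroup F] [NormedSpace ℝ F]

/-- Squared form of the mean value inequality along a segment. -/
lemma enorm_sub_sq_le_lintegral_segment {w : F → ℝ} (hw : ContDiff ℝ 1 w) (x y : F) :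
    ‖w x - w y‖ₑ ^ 2 ≤
      ‖x - y‖ₑ ^ 2 * ∫⁻ t in Set.Icc (0 : ℝ) 1, ‖fderiv ℝ w (y + t • (x - y))‖ₑ ^ 2 := by
  have hc : Continuous fun t : ℝ => fderiv ℝ w (y + t • (x - y)) :=
    (hw.continuous_fderiv one_ne_zero).comp (by fun_prop)
  have hderiv : ∀ t : ℝ, HasDerivAt (fun t : ℝ => w (y + t • (x - y)))
      (fderiv ℝ w (y + t • (x - y)) (x - y)) t := fun t => by
    have h1 : HasDerivAt (fun t : ℝ => y + t • (x - y)) (x - y) t := by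
      simpa using ((hasDerivAt_id t).smul_const (x - y)).const_add y
    exact ((hw.differentiable one_ne_zero) _).hasFDerivAt.comp_hasDerivAt t h1
  have hftc : w x - w y = ∫ t in (0 : ℝ)..1, fderiv ℝ w (y + t • (x - y)) (x - y) := by
    rw [intervalIntegral.integral_eq_sub_of_hasDerivAt (fun t _ => hderiv t)
      ((hc.clm_apply continuous_const).intervalIntegrable _ _)]
    simp
  have hle : ‖w x - w y‖ₑ ≤
      ‖x - y‖ₑ * ∫⁻ t in Set.Icc (0 : ℝ) 1, ‖fderiv ℝ w (y + t • (x - y))‖ₑ := by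
    rw [hftc, intervalIntegral.integral_of_le zero_le_one, ← integral_Icc_eq_integral_Ioc,
      ← lintegral_const_mul _ hc.enorm.measurable]
    refine (enorm_integral_le_lintegral_enorm _).trans (lintegral_mono fun t => ?_)
    rw [mul_comm]
    exact ContinuousLinearMap.le_opENorm _ _
  have hjensen : (∫⁻ t in Set.Icc (0 : ℝ) 1, ‖fderiv ℝ w (y + t • (x - y))‖ₑ) ^ 2 ≤
      ∫⁻ t in Set.Icc (0 : ℝ) 1, ‖fderiv ℝ w (y + t • (x - y))‖ₑ ^ 2 := by
    -- Cauchy–Schwarz against the constant `1`, on an interval of length one.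
    have h := ENNReal.lintegral_mul_le_Lp_mul_Lq (volume.restrict (Set.Icc (0 : ℝ) 1))
      Real.HolderConjugate.two_two (f := fun t => ‖fderiv ℝ w (y + t • (x - y))‖ₑ)
      (g := fun _ => 1) (by fun_prop) (by fun_prop)
    simp only [Pi.mul_apply, mul_one, ENNReal.rpow_ofNat, one_pow, lintegral_one,
      Measure.restrict_apply_univ, Real.volume_Icc, sub_zero, ENNReal.ofReal_one,
      ENNReal.one_rpow] at h
    calc _ ≤ ((∫⁻ t in Set.Icc (0 : ℝ) 1, ‖fderiv ℝ w (y + t • (x - y))‖ₑ ^ 2) ^ (1 / 2 : ℝ)) ^ 2 :=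
          pow_le_pow_left' h 2
      _ = _ := by
          rw [← ENNReal.rpow_natCast, ← ENNReal.rpow_mul]; norm_num
  calc _ ≤ (‖x - y‖ₑ * ∫⁻ t in Set.Icc (0 : ℝ) 1, ‖fderiv ℝ w (y + t • (x - y))‖ₑ) ^ 2 :=
        pow_le_pow_left' hle 2
    _ ≤ _ := by rw [mul_pow]; gcongr

variable [FiniteDimensional ℝ F] [MeasurableSpace F] [BorelSpace F]
  (μ : Measure F) [μ.IsAddHaarMeasure]

lemma lintegral_comp_const_add_smul {t : ℝ} (ht : 0 < t) (a : F) (g : F → ENNReal) :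
    ∫⁻ x, g (a + t • x) ∂μ
      = ENNReal.ofReal ((t ^ Module.finrank ℝ F)⁻¹) * ∫⁻ x, g x ∂μ := by
  have h1 : ∫⁻ x, g (a + t • x) ∂μ = ∫⁻ z, g (a + z) ∂(Measure.map (t • ·) μ) :=
    ((Homeomorph.smulOfNeZero t ht.ne').measurableEmbedding.lintegral_map
      (fun z => g (a + z))).symm
  rw [h1, Measure.map_addHaar_smul μ ht.ne', lintegral_smul_measure,
    lintegral_add_left_eq_self g a, abs_of_pos (by positivity), smul_eq_mul]

/-- The homothety of ratio `t` centred at `y` maps the convex set `K` into itself, and its change of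
variables costs `t⁻¹` to the power of the dimension, where `t⁻¹ ≤ 2`. -/
lemma lintegral_contraction_le {K : Set F} (hK : Convex ℝ K) (hKm : MeasurableSet K)
    {g : F → ENNReal} {t : ℝ} (ht : 1 / 2 ≤ t) (ht1 : t ≤ 1) {y : F} (hy : y ∈ K) :
    ∫⁻ x in K, g (y + t • (x - y)) ∂μ ≤ 2 ^ Module.finrank ℝ F * ∫⁻ x in K, g x ∂μ := by
  have ht0 : 0 < t := by linarith
  rw [← lintegral_indicator hKm, ← lintegral_indicator hKm]
  calc _ ≤ ∫⁻ x, K.indicator g ((y - t • y) + t • x) ∂μ := by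
        refine lintegral_mono fun x => ?_
        have he : y + t • (x - y) = (y - t • y) + t • x := by rw [smul_sub]; abel
        by_cases hx : x ∈ K
        · have hm : (y - t • y) + t • x ∈ K := by
            rw [← he]
            exact hK.add_smul_sub_mem hy hx ⟨ht0.le, ht1⟩
          simp only [Set.indicator_of_mem hx, Set.indicator_of_mem hm, he, le_refl]
        · simp [Set.indicator_of_notMem hx]
    _ = _ := lintegral_comp_const_add_smul μ ht0 _ _
    _ ≤ _ := by
        gcongr
        rw [← inv_pow, ENNReal.ofReal_pow (by positivity)]
        gcongr
        rw [ENNReal.ofReal_le_iff_le_toReal (by simp)]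
        rw [inv_le_comm₀ ht0 (by simp)]
        simpa using ht

lemma lintegral_lintegral_segment_le {K : Set F} (hK : Convex ℝ K) (hKm : MeasurableSet K)
    (hKfin : μ K ≠ ⊤) {g : F → ENNReal} (hg : Measurable g) {t : ℝ} (ht0 : 0 ≤ t) (ht1 : t ≤ 1) :
    ∫⁻ x in K, ∫⁻ y in K, g (y + t • (x - y)) ∂μ ∂μ
      ≤ 2 ^ Module.finrank ℝ F * μ K * ∫⁻ x in K, g x ∂μ := by
  have hconst : ∫⁻ _ in K, 2 ^ Module.finrank ℝ F * ∫⁻ x in K, g x ∂μ ∂μ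
      = 2 ^ Module.finrank ℝ F * μ K * ∫⁻ x in K, g x ∂μ := by
    rw [setLIntegral_const]; ring
  have : Fact (μ K < ⊤) := ⟨hKfin.lt_top⟩
  rw [← hconst]
  -- The substitution degenerates as `t → 0`, so the contraction is taken towards `y` when `t ≥
  -- 1/2`, and otherwise towards `x` with ratio `1 - t`.
  rcases le_total (1 / 2) t with h | h
  · rw [lintegral_lintegral_swap (by fun_prop)]
    exact setLIntegral_mono' hKm fun y hy => lintegral_contraction_le μ hK hKm h ht1 hy
  · refine setLIntegral_mono' hKm fun x hx => ?_
    refine le_trans (le_of_eq ?_)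
      (lintegral_contraction_le μ hK hKm (t := 1 - t) (by linarith) (by linarith) hx)
    refine lintegral_congr fun y => ?_
    congr 1
    module

/-- Poincaré inequality, in double integral form, on a convex set of diameter at most `d`. -/
lemma lintegral_lintegral_enorm_sub_sq_le {K : Set F} (hK : Convex ℝ K) (hKm : MeasurableSet K)
    (hKfin : μ K ≠ ⊤) {d : ENNReal} (hd : ∀ x ∈ K, ∀ y ∈ K, ‖x - y‖ₑ ≤ d)
    {w : F → ℝ} (hw : ContDiff ℝ 1 w) :
    ∫⁻ x in K, ∫⁻ y in K, ‖w x - w y‖ₑ ^ 2 ∂μ ∂μ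
      ≤ d ^ 2 * (2 ^ Module.finrank ℝ F * μ K * ∫⁻ x in K, ‖fderiv ℝ w x‖ₑ ^ 2 ∂μ) := by
  have hc : Continuous (fderiv ℝ w) := hw.continuous_fderiv one_ne_zero
  have : Fact (μ K < ⊤) := ⟨hKfin.lt_top⟩
  have hcont : Continuous fun p : (F × F) × ℝ =>
      ‖fderiv ℝ w (p.1.2 + p.2 • (p.1.1 - p.1.2))‖ₑ ^ 2 := by
    have h1 : Continuous fun p : (F × F) × ℝ => fderiv ℝ w (p.1.2 + p.2 • (p.1.1 - p.1.2)) :=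
      hc.comp (by fun_prop)
    fun_prop
  calc _ ≤ ∫⁻ x in K, ∫⁻ y in K,
        (d ^ 2 * ∫⁻ t in Set.Icc (0 : ℝ) 1, ‖fderiv ℝ w (y + t • (x - y))‖ₑ ^ 2) ∂μ ∂μ := by
        refine setLIntegral_mono' hKm fun x hx => setLIntegral_mono' hKm fun y hy => ?_
        refine (enorm_sub_sq_le_lintegral_segment hw x y).trans ?_
        gcongr
        exact hd x hx y hy
    _ = d ^ 2 * ∫⁻ t in Set.Icc (0 : ℝ) 1, ∫⁻ x in K, ∫⁻ y in K,
          ‖fderiv ℝ w (y + t • (x - y))‖ₑ ^ 2 ∂μ ∂μ := by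
        exact lintegral_lintegral_const_mul_lintegral (μ.restrict K)
          (volume.restrict (Set.Icc (0 : ℝ) 1)) (d ^ 2) hcont.measurable
    _ ≤ d ^ 2 * ∫⁻ _ in Set.Icc (0 : ℝ) 1,
          2 ^ Module.finrank ℝ F * μ K * ∫⁻ x in K, ‖fderiv ℝ w x‖ₑ ^ 2 ∂μ := by
        refine mul_le_mul_right ?_ _
        exact setLIntegral_mono' measurableSet_Icc fun t ht =>
          lintegral_lintegral_segment_le μ hK hKm hKfin (g := fun z => ‖fderiv ℝ w z‖ₑ ^ 2)
            (by fun_prop) ht.1 ht.2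
    _ = _ := by simp

end Poincare

/-- The variance identity for a finite measure that need not be normalized. -/
lemma integral_integral_sub_sq {α : Type*} [MeasurableSpace α] (ν : Measure α)
    [IsFiniteMeasure ν] {w : α → ℝ} (hw : MemLp w 2 ν) :
    ∫ x, ∫ y, (w x - w y) ^ 2 ∂ν ∂ν
      = 2 * (ν.real Set.univ * ∫ x, w x ^ 2 ∂ν - (∫ x, w x ∂ν) ^ 2) := by
  have h1 : Integrable w ν := hw.integrable (by norm_num)
  have h2 : Integrable (fun x => w x ^ 2) ν := hw.integrable_sq
  have hin : ∀ x, ∫ y, (w x - w y) ^ 2 ∂ν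
      = ν.real Set.univ * w x ^ 2 - 2 * w x * ∫ y, w y ∂ν + ∫ y, w y ^ 2 ∂ν := fun x => by
    have : ∀ y, (w x - w y) ^ 2 = w x ^ 2 - 2 * w x * w y + w y ^ 2 := fun y => by ring
    simp_rw [this]
    rw [integral_add (by fun_prop) h2, integral_sub (by fun_prop) (by fun_prop),
      integral_const_mul]
    simp
  simp_rw [hin]
  rw [integral_add (by fun_prop) (by fun_prop), integral_sub (by fun_prop) (by fun_prop),
    integral_mul_const, integral_const_mul, integral_const_mul]
  simp only [integral_const, smul_eq_mul]
  ring

/-! ### The ground state inequality -/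

section Energy

variable {n : ℕ}

lemma gradient_apply (u : E n → ℝ) (x : E n) (i : Fin n) :
    gradient u x i = fderiv ℝ u x (EuclideanSpace.single i 1) := by
  have h : inner ℝ (gradient u x) (EuclideanSpace.single i (1 : ℝ))
      = fderiv ℝ u x (EuclideanSpace.single i 1) := InnerProductSpace.toDual_symm_apply
  rw [← h, EuclideanSpace.inner_single_right]
  simp

lemma norm_gradient (u : E n → ℝ) (x : E n) : ‖gradient u x‖ = ‖fderiv ℝ u x‖ :=
  LinearIsometryEquiv.norm_map _ _

lemma norm_gradient_sq (u : E n → ℝ) (x : E n) :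
    ‖gradient u x‖ ^ 2 = ∑ i, fderiv ℝ u x (EuclideanSpace.single i 1) ^ 2 := by
  simp [EuclideanSpace.real_norm_sq_eq, gradient_apply]

lemma continuous_gradient {u : E n → ℝ} (hu : ContDiff ℝ 1 u) : Continuous (gradient u) :=
  (InnerProductSpace.toDual ℝ (E n)).symm.continuous.comp (hu.continuous_fderiv one_ne_zero)

lemma hasCompactSupport_gradient {u : E n → ℝ} (hu : HasCompactSupport u) :
    HasCompactSupport (gradient u) :=
  (hu.fderiv (𝕜 := ℝ)).comp_left (g := (InnerProductSpace.toDual ℝ (E n)).symm) (map_zero _)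

lemma gradient_sub {u w : E n → ℝ} (hu : ContDiff ℝ 1 u) (hw : ContDiff ℝ 1 w) (x : E n) :
    gradient (fun y => u y - w y) x = gradient u x - gradient w x := by
  unfold gradient
  rw [fderiv_fun_sub ((hu.differentiable one_ne_zero) x) ((hw.differentiable one_ne_zero) x),
    map_sub]

/-- One coordinate of the ground state inequality. -/
lemma directional_energy_nonneg {u p : E n → ℝ} (hu : ContDiff ℝ 1 u) (hus : HasCompactSupport u)
    (hp : ContDiff ℝ 2 p) (e : E n) :
    0 ≤ ∫ x, Real.exp (2 * p x) * (fderiv ℝ u x e ^ 2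
      - u x ^ 2 * (fderiv ℝ (fun y => fderiv ℝ p y e) x e + fderiv ℝ p x e ^ 2)) := by
  have hp1 : ContDiff ℝ 1 p := hp.of_le (by norm_num)
  have hdp : ContDiff ℝ 1 fun y => fderiv ℝ p y e :=
    (hp.fderiv_right (m := 1) (by norm_num)).clm_apply contDiff_const
  have hcdu : Continuous fun x => fderiv ℝ u x e :=
    (hu.continuous_fderiv one_ne_zero).clm_apply continuous_const
  have hcddp : Continuous fun x => fderiv ℝ (fun y => fderiv ℝ p y e) x e :=
    (hdp.continuous_fderiv one_ne_zero).clm_apply continuous_const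
  have hcp := hp.continuous
  have hcu := hu.continuous
  have hcdp := hdp.continuous
  -- The derivative of `f * u` along `e` contains the cross term of the square `(∂u + u ∂p)²`, and
  -- its integral vanishes.
  set f : E n → ℝ := fun x => Real.exp (2 * p x) * u x * fderiv ℝ p x e with hf
  have hfC : ContDiff ℝ 1 f := ((contDiff_const.mul hp1).exp.mul hu).mul hdp
  have hfs : HasCompactSupport f := (hus.mul_left).mul_right
  have hdf : ∀ x, fderiv ℝ f x e = Real.exp (2 * p x) * (2 * fderiv ℝ p x e ^ 2 * u x
      + fderiv ℝ u x e * fderiv ℝ p x e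
      + u x * fderiv ℝ (fun y => fderiv ℝ p y e) x e) := fun x => by
    have h1 := ((hp1.differentiable one_ne_zero) x).hasFDerivAt
    have h2 := ((hu.differentiable one_ne_zero) x).hasFDerivAt
    have h3 := ((hdp.differentiable one_ne_zero) x).hasFDerivAt
    have h4 := (((h1.const_mul 2).exp).mul h2).mul h3
    rw [show fderiv ℝ f x = _ from h4.fderiv]
    simp
    ring
  have hcdf : Continuous fun x => fderiv ℝ f x e :=
    (hfC.continuous_fderiv one_ne_zero).clm_apply continuous_const
  have hi1 : Integrable fun x => fderiv ℝ f x e * u x :=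
    (hcdf.mul hcu).integrable_of_hasCompactSupport hus.mul_left
  have hi2 : Integrable fun x => f x * fderiv ℝ u x e :=
    (hfC.continuous.mul hcdu).integrable_of_hasCompactSupport hfs.mul_right
  have hi3 : Integrable fun x => f x * u x :=
    (hfC.continuous.mul hcu).integrable_of_hasCompactSupport hfs.mul_right
  have hibp := integral_mul_fderiv_eq_neg_fderiv_mul_of_integrable hi1 hi2 hi3
    (fun x _ => (hfC.differentiable one_ne_zero) x) (fun x _ => (hu.differentiable one_ne_zero) x)
  have hdus : HasCompactSupport fun x => fderiv ℝ u x e := hus.fderiv_apply (𝕜 := ℝ) e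
  have hi4 : Integrable fun x =>
      Real.exp (2 * p x) * (fderiv ℝ u x e + u x * fderiv ℝ p x e) ^ 2 := by
    refine Continuous.integrable_of_hasCompactSupport (by fun_prop) ?_
    refine HasCompactSupport.mul_left ?_
    exact (hdus.add hus.mul_right).comp_left (g := fun t : ℝ => t ^ 2) (by norm_num)
  have heq : ∀ x, Real.exp (2 * p x) * (fderiv ℝ u x e ^ 2
      - u x ^ 2 * (fderiv ℝ (fun y => fderiv ℝ p y e) x e + fderiv ℝ p x e ^ 2))
      = Real.exp (2 * p x) * (fderiv ℝ u x e + u x * fderiv ℝ p x e) ^ 2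
        - fderiv ℝ f x e * u x - f x * fderiv ℝ u x e := fun x => by
    rw [hdf, hf]; ring
  simp_rw [heq]
  rw [integral_sub (by exact hi4.sub hi1) hi2, integral_sub hi4 hi1, hibp]
  have : 0 ≤ ∫ x, Real.exp (2 * p x) * (fderiv ℝ u x e + u x * fderiv ℝ p x e) ^ 2 :=
    integral_nonneg fun x => by positivity
  linarith

lemma integral_potential_le {u p : E n → ℝ} (hu : ContDiff ℝ 1 u) (hus : HasCompactSupport u)
    (hp : ContDiff ℝ 2 p) :
    ∫ x, Real.exp (2 * p x) * ((hessian p x).trace + ‖gradient p x‖ ^ 2) * u x ^ 2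
      ≤ ∫ x, Real.exp (2 * p x) * ‖gradient u x‖ ^ 2 := by
  have hp1 : ContDiff ℝ 1 p := hp.of_le (by norm_num)
  have hcu := hu.continuous
  have hcp := hp.continuous
  have hcdu : ∀ i : Fin n, Continuous fun x => fderiv ℝ u x (EuclideanSpace.single i 1) :=
    fun i => (hu.continuous_fderiv one_ne_zero).clm_apply continuous_const
  have hdp : ∀ i : Fin n, ContDiff ℝ 1 fun y => fderiv ℝ p y (EuclideanSpace.single i 1) :=
    fun i => (hp.fderiv_right (m := 1) (by norm_num)).clm_apply contDiff_const
  have hcddp : ∀ i : Fin n, Continuous fun x =>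
      fderiv ℝ (fun y => fderiv ℝ p y (EuclideanSpace.single i 1)) x
        (EuclideanSpace.single i 1) := fun i =>
    ((hdp i).continuous_fderiv one_ne_zero).clm_apply continuous_const
  have hcdp := fun i => (hdp i).continuous
  have husq : HasCompactSupport fun x => u x ^ 2 :=
    hus.comp_left (g := fun t : ℝ => t ^ 2) (by norm_num)
  have hi1 : ∀ i : Fin n, Integrable fun x => Real.exp (2 * p x)
      * (fderiv ℝ (fun y => fderiv ℝ p y (EuclideanSpace.single i 1)) x (EuclideanSpace.single i 1)
        + fderiv ℝ p x (EuclideanSpace.single i 1) ^ 2) * u x ^ 2 := fun i =>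
    Continuous.integrable_of_hasCompactSupport (by fun_prop) husq.mul_left
  have hi2 : ∀ i : Fin n, Integrable fun x =>
      Real.exp (2 * p x) * fderiv ℝ u x (EuclideanSpace.single i 1) ^ 2 := fun i => by
    refine Continuous.integrable_of_hasCompactSupport (by fun_prop) ?_
    exact HasCompactSupport.mul_left ((hus.fderiv_apply (𝕜 := ℝ) _).comp_left
      (g := fun t : ℝ => t ^ 2) (by norm_num))
  have h1 : ∀ x, Real.exp (2 * p x) * ((hessian p x).trace + ‖gradient p x‖ ^ 2) * u x ^ 2
      = ∑ i, Real.exp (2 * p x)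
      * (fderiv ℝ (fun y => fderiv ℝ p y (EuclideanSpace.single i 1)) x (EuclideanSpace.single i 1)
        + fderiv ℝ p x (EuclideanSpace.single i 1) ^ 2) * u x ^ 2 := fun x => by
    rw [norm_gradient_sq, ← Finset.sum_mul, ← Finset.mul_sum, Finset.sum_add_distrib]
    rfl
  simp_rw [h1, norm_gradient_sq u, Finset.mul_sum]
  rw [integral_finsetSum _ fun i _ => hi1 i, integral_finsetSum _ fun i _ => hi2 i]
  refine Finset.sum_le_sum fun i _ => ?_
  rw [← sub_nonneg, ← integral_sub (hi2 i) (hi1 i)]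
  refine (directional_energy_nonneg hu hus hp (EuclideanSpace.single i 1)).trans_eq ?_
  exact integral_congr_ae (.of_forall fun x => by ring)

lemma exp_logPotential {q : E n → ℝ} (hq : IsC1Density q) (x : E n) :
    Real.exp (-(2 * logPotential q x)) = q x := by
  have h := hq.pos x
  rw [logPotential, Real.log_sqrt h.le]
  rw [show -(2 * -(Real.log (q x) / 2)) = Real.log (q x) by ring, Real.exp_log h]

/-- The potential whose divergence at infinity is the tail criterion. -/
def tailPotential (q v : E n → ℝ) (x : E n) : ℝ :=
  Real.exp (v x) ^ 2 * (hessian v x - hessian (logPotential q) x).trace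
      + Real.exp (v x) ^ 2 * ‖gradient (logPotential q) x - gradient v x‖ ^ 2

lemma hessian_sub {u w : E n → ℝ} (hu : ContDiff ℝ 2 u) (hw : ContDiff ℝ 2 w) (x : E n) :
    hessian (fun y => u y - w y) x = hessian u x - hessian w x := by
  have hd : ∀ {f : E n → ℝ}, ContDiff ℝ 2 f → ∀ e, Differentiable ℝ fun y => fderiv ℝ f y e :=
    fun hf e => ((hf.fderiv_right (m := 1) (by norm_num)).clm_apply
      contDiff_const).differentiable one_ne_zero
  ext i j
  have h1 : (fun y => fderiv ℝ (fun y => u y - w y) y (EuclideanSpace.single j 1))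
      = fun y => fderiv ℝ u y (EuclideanSpace.single j 1)
        - fderiv ℝ w y (EuclideanSpace.single j 1) := by
    ext y
    rw [fderiv_fun_sub ((hu.differentiable (by norm_num)) y)
      ((hw.differentiable (by norm_num)) y)]
    rfl
  simp only [hessian, Matrix.of_apply, Matrix.sub_apply, h1]
  rw [fderiv_fun_sub (hd hu _ x) (hd hw _ x)]
  rfl

lemma continuous_hessian_trace {u : E n → ℝ} (hu : ContDiff ℝ 2 u) :
    Continuous fun x => (hessian u x).trace := by
  refine continuous_finsetSum _ fun i _ => ?_
  exact (((hu.fderiv_right (m := 1) (by norm_num)).clm_apply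
    contDiff_const).continuous_fderiv one_ne_zero).clm_apply continuous_const

lemma continuous_tailPotential {q v : E n → ℝ} (hh : ContDiff ℝ 2 (logPotential q))
    (hv : ContDiff ℝ 2 v) : Continuous (tailPotential q v) := by
  have h1 := continuous_hessian_trace hh
  have h2 := continuous_hessian_trace hv
  have h3 := continuous_gradient (hh.of_le (m := 1) (by norm_num))
  have h4 := continuous_gradient (hv.of_le (m := 1) (by norm_num))
  have h5 := hv.continuous
  unfold tailPotential
  simp_rw [Matrix.trace_sub]
  fun_prop

/-- The form controls the tail potential. -/
lemma integral_tailPotential_le {q v u : E n → ℝ} (hq : IsC1Density q)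
    (hh : ContDiff ℝ 2 (logPotential q)) (hv : ContDiff ℝ 2 v)
    (hu : ContDiff ℝ 1 u) (hus : HasCompactSupport u) :
    ∫ x, tailPotential q v x * u x ^ 2 * q x
      ≤ ∫ x, Real.exp (v x) ^ 2 * ‖gradient u x‖ ^ 2 * q x := by
  have hexp : ∀ x, Real.exp (2 * (v x - logPotential q x)) = Real.exp (v x) ^ 2 * q x :=
    fun x => by
      rw [← exp_logPotential hq x, ← Real.exp_nat_mul, ← Real.exp_add]
      congr 1
      push_cast
      ring
  -- The ground state exponent is `p = v - h`, which turns the weight `exp (2p)` into `ς² q`.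
  have h := integral_potential_le hu hus (hv.sub hh)
  refine le_of_eq_of_le ?_ (h.trans_eq ?_)
  · refine integral_congr_ae (.of_forall fun x => ?_)
    simp only [hexp, tailPotential]
    rw [hessian_sub hv hh, gradient_sub (hv.of_le (by norm_num)) (hh.of_le (by norm_num)),
      norm_sub_rev]
    ring
  · refine integral_congr_ae (.of_forall fun x => ?_)
    simp only [hexp]
    ring

end Energy

/-! ### Total boundedness criterion and partition of a ball -/

/-- A bounded set is totally bounded if finitely many continuous functionals control the distance
of its points up to any given error. -/
lemma totallyBounded_of_finite_functionals {X ι : Type*} [NormedAddCommGroup X] [NormedSpace ℝ X]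
    {T : Set X} (hT : Bornology.IsBounded T)
    (H : ∀ ε > (0 : ℝ), ∃ (s : Finset ι) (ℓ : ι → X →L[ℝ] ℝ) (η : ℝ), 0 < η ∧
      ∀ x ∈ T, ∀ y ∈ T, (∀ k ∈ s, |ℓ k (x - y)| < η) → ‖x - y‖ < ε) : TotallyBounded T := by
  rw [Metric.totallyBounded_iff]
  intro ε hε
  obtain ⟨s, ℓ, η, hη, h⟩ := H ε hε
  let L : X →L[ℝ] (s → ℝ) := ContinuousLinearMap.pi fun k => ℓ k
  have hL : TotallyBounded (L '' T) := 
    -- The image is a bounded subset of a finite-dimensional space.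
    ((L.lipschitz.isBounded_image hT).isCompact_closure).totallyBounded.subset subset_closure
  obtain ⟨c, hcT, hcfin, hc⟩ := hL.exists_subset (Metric.dist_mem_uniformity hη)
  -- The net is chosen inside `L '' T`, so its points lift to `T`, where the hypothesis on pairs
  -- applies.
  have hcT' : ∀ y ∈ c, ∃ x ∈ T, L x = y := hcT
  choose! f hf using hcT'
  refine ⟨f '' c, hcfin.image f, fun x hx => ?_⟩
  obtain ⟨y, hy, hxy⟩ := Set.mem_iUnion₂.1 (hc (Set.mem_image_of_mem L hx))
  refine Set.mem_iUnion₂.2 ⟨f y, Set.mem_image_of_mem f hy, ?_⟩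
  rw [Metric.mem_ball, dist_eq_norm]
  refine h x hx (f y) (hf y hy).1 fun k hk => ?_
  have h1 : dist (L x) y < η := hxy
  rw [← (hf y hy).2, dist_eq_norm, ← map_sub] at h1
  exact (norm_le_pi_norm (L (x - f y)) ⟨k, hk⟩).trans_lt h1

/-- The pieces are half-open grid cubes intersected with the ball: half-open for disjointness,
intersected so that the union is exactly the ball. The side `d / (n + 1)` keeps the diameter below
`d` because `n ≤ (n + 1)²`, and `n + 1` avoids division by zero in dimension zero. -/
lemma exists_convex_partition (n : ℕ) (R : ℝ) {d : ℝ} (hd : 0 < d) :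
    ∃ (s : Finset (Fin n → ℤ)) (K : (Fin n → ℤ) → Set (E n)),
      (∀ k, Convex ℝ (K k)) ∧ (∀ k, MeasurableSet (K k)) ∧
      (∀ k, ∀ x ∈ K k, ∀ y ∈ K k, ‖x - y‖ ≤ d) ∧ Pairwise (Function.onFun Disjoint K) ∧
      ⋃ k ∈ s, K k = Metric.closedBall 0 R := by
  set δ : ℝ := d / (n + 1) with hδ
  have hδ0 : 0 < δ := by positivity
  let K : (Fin n → ℤ) → Set (E n) := fun k =>
    (⋂ i, (fun x : E n => x i) ⁻¹' Set.Ico (k i * δ) ((k i + 1) * δ)) ∩ Metric.closedBall 0 R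
  have hmem : ∀ k x, x ∈ K k ↔ (∀ i, ⌊x i / δ⌋ = k i) ∧ x ∈ Metric.closedBall 0 R := fun k x => by
    simp only [K, Set.mem_inter_iff, Set.mem_iInter, Set.mem_preimage, Set.mem_Ico]
    refine and_congr_left fun _ => forall_congr' fun i => ?_
    rw [Int.floor_eq_iff, le_div_iff₀ hδ0, div_lt_iff₀ hδ0]
  have hcoord : ∀ (x : E n) i, |x i| ≤ ‖x‖ := fun x i => PiLp.norm_apply_le x i
  refine ⟨Fintype.piFinset fun _ => Finset.Icc ⌊-R / δ⌋ ⌊R / δ⌋, K, fun k => ?_, fun k => ?_,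
    fun k x hx y hy => ?_, fun k l hkl => ?_, ?_⟩
  · refine (convex_iInter fun i => ?_).inter (convex_closedBall _ _)
    exact (convex_Ico _ _).linear_preimage (EuclideanSpace.proj i : E n →L[ℝ] ℝ).toLinearMap
  · refine (MeasurableSet.iInter fun i => ?_).inter Metric.isClosed_closedBall.measurableSet
    exact measurableSet_Ico.preimage (by fun_prop)
  · have hxy : ∀ i, (x - y) i ^ 2 ≤ δ ^ 2 := fun i => by
      have h1 := (Int.floor_eq_iff.1 (((hmem k x).1 hx).1 i))
      have h2 := (Int.floor_eq_iff.1 (((hmem k y).1 hy).1 i))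
      rw [le_div_iff₀ hδ0, div_lt_iff₀ hδ0] at h1 h2
      refine sq_le_sq' ?_ ?_ <;> simp only [PiLp.sub_apply] <;> nlinarith
    have hsq : ‖x - y‖ ^ 2 ≤ d ^ 2 := by
      rw [EuclideanSpace.real_norm_sq_eq]
      calc _ ≤ ∑ _i : Fin n, δ ^ 2 := Finset.sum_le_sum fun i _ => hxy i
        _ = n * δ ^ 2 := by simp
        _ ≤ ((n + 1) * δ) ^ 2 := by
            rw [mul_pow]
            gcongr
            nlinarith [(Nat.cast_nonneg n : (0 : ℝ) ≤ n)]
        _ = d ^ 2 := by rw [hδ]; field_simp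
    exact (sq_le_sq₀ (norm_nonneg _) hd.le).1 hsq
  · refine Set.disjoint_left.2 fun x hx hx' => hkl ?_
    ext i
    rw [← ((hmem k x).1 hx).1 i, ((hmem l x).1 hx').1 i]
  · ext x
    simp only [Set.mem_iUnion, hmem, Fintype.mem_piFinset, Finset.mem_Icc]
    refine ⟨fun ⟨k, _, h⟩ => h.2, fun hx => ⟨fun i => ⌊x i / δ⌋, fun i => ?_, fun _ => rfl, hx⟩⟩
    have h1 := abs_le.1 ((hcoord x i).trans (mem_closedBall_zero_iff.1 hx))
    exact ⟨Int.floor_le_floor (by gcongr; exact h1.1), Int.floor_le_floor (by gcongr; exact h1.2)⟩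

/-! ### The measure `Q` and its Poincaré inequality -/

section Law

variable {n : ℕ} {q : E n → ℝ}

lemma IsC1Density.isProbabilityMeasure_law (hq : IsC1Density q) :
    IsProbabilityMeasure (law q) := by
  refine ⟨?_⟩
  rw [withDensity_apply _ MeasurableSet.univ, setLIntegral_univ,
    ← ofReal_integral_eq_lintegral_ofReal hq.integrable (.of_forall fun x => (hq.pos x).le),
    hq.integral_eq_one, ENNReal.ofReal_one]

lemma IsC1Density.measurable_ofReal (hq : IsC1Density q) :
    Measurable fun x => ENNReal.ofReal (q x) :=
  hq.contDiff.continuous.measurable.ennreal_ofReal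

lemma IsC1Density.volume_absolutelyContinuous (hq : IsC1Density q) :
    (volume : Measure (E n)) ≪ law q :=
  withDensity_absolutelyContinuous' hq.measurable_ofReal.aemeasurable
    (.of_forall fun x => by simpa using hq.pos x)

lemma setIntegral_law (hq : IsC1Density q) {s : Set (E n)} (hs : MeasurableSet s) (f : E n → ℝ) :
    ∫ x in s, f x ∂law q = ∫ x in s, f x * q x := by
  rw [setIntegral_withDensity_eq_setIntegral_toReal_smul hq.measurable_ofReal
    (.of_forall fun x => ENNReal.ofReal_lt_top) f hs]
  refine integral_congr_ae (.of_forall fun x => ?_)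
  simp [ENNReal.toReal_ofReal (hq.pos x).le, mul_comm]

lemma integral_law (hq : IsC1Density q) (f : E n → ℝ) :
    ∫ x, f x ∂law q = ∫ x, f x * q x := by
  rw [← setIntegral_univ, setIntegral_law hq .univ, setIntegral_univ]

lemma restrict_law_le {K : Set (E n)} (hK : MeasurableSet K) {M : ℝ}
    (hM : ∀ x ∈ K, q x ≤ M) :
    (law q).restrict K ≤ ENNReal.ofReal M • volume.restrict K := by
  rw [restrict_withDensity hK, ← withDensity_const]
  refine withDensity_mono ?_
  filter_upwards [ae_restrict_mem hK] with x hx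
  exact ENNReal.ofReal_le_ofReal (hM x hx)

lemma ofReal_mul_volume_le_law {K : Set (E n)} (hK : MeasurableSet K) {m : ℝ}
    (hm : ∀ x ∈ K, m ≤ q x) : ENNReal.ofReal m * volume K ≤ law q K := by
  rw [withDensity_apply _ hK, ← setLIntegral_const]
  exact setLIntegral_mono' hK fun x hx => ENNReal.ofReal_le_ofReal (hm x hx)

/-- Poincaré inequality on a convex set for the measure with density `q`. -/
lemma setIntegral_law_sq_le (hq : IsC1Density q) {K : Set (E n)} (hK : Convex ℝ K)
    (hKm : MeasurableSet K) (hKfin : volume K ≠ ⊤) {m M d : ℝ} (hm0 : 0 < m) (hM0 : 0 ≤ M)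
    (hd0 : 0 ≤ d) (hm : ∀ x ∈ K, m ≤ q x) (hM : ∀ x ∈ K, q x ≤ M)
    (hd : ∀ x ∈ K, ∀ y ∈ K, ‖x - y‖ ≤ d) {w : E n → ℝ} (hw : ContDiff ℝ 1 w)
    (hws : HasCompactSupport w) :
    ∫ x in K, w x ^ 2 ∂law q ≤ 2 ^ n * M ^ 2 / (2 * m) * d ^ 2 * (∫ x in K, ‖gradient w x‖ ^ 2)
      + ((law q).real K)⁻¹ * (∫ x in K, w x ∂law q) ^ 2 := by
  have := hq.isProbabilityMeasure_law
  have hcw := hw.continuous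
  have hcg := continuous_gradient hw
  set ν := (law q).restrict K with hν
  have hwm : MemLp w 2 ν := hcw.memLp_of_hasCompactSupport hws
  set D := ∫ x in K, ‖gradient w x‖ ^ 2 with hD
  have hD0 : 0 ≤ D := integral_nonneg fun x => by positivity
  have hDi : Integrable (fun x => ‖gradient w x‖ ^ 2) (volume.restrict K) := by
    refine (Continuous.integrable_of_hasCompactSupport (by fun_prop) ?_).restrict
    exact (hasCompactSupport_gradient hws).comp_left (g := fun z : E n => ‖z‖ ^ 2) (by simp)
  have hvar := integral_integral_sub_sq ν hwm
  -- Both copies of `Q` are replaced by `M` times Lebesgue measure, whence `M ^ 2`. The volume of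
  -- `K` is later traded for `Q(K) / m`, and the factor `1/2` comes from the variance identity.
  have hlin : ∫⁻ x, ∫⁻ y, ‖w x - w y‖ₑ ^ 2 ∂ν ∂ν
      ≤ ENNReal.ofReal (2 ^ n * M ^ 2 * d ^ 2 * volume.real K * D) := by
    have hνM := restrict_law_le hKm hM
    calc _ ≤ ∫⁻ x, ∫⁻ y, ‖w x - w y‖ₑ ^ 2 ∂(ENNReal.ofReal M • volume.restrict K)
          ∂(ENNReal.ofReal M • volume.restrict K) :=
          lintegral_mono' hνM fun x => lintegral_mono' hνM le_rfl
      _ = ENNReal.ofReal M ^ 2 * ∫⁻ x in K, ∫⁻ y in K, ‖w x - w y‖ₑ ^ 2 := by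
          simp_rw [lintegral_smul_measure, smul_eq_mul]
          rw [lintegral_const_mul' _ _ ENNReal.ofReal_ne_top]
          ring
      _ ≤ ENNReal.ofReal M ^ 2 * (ENNReal.ofReal d ^ 2 * (2 ^ Module.finrank ℝ (E n) * volume K
            * ∫⁻ x in K, ‖fderiv ℝ w x‖ₑ ^ 2)) := by
          refine mul_le_mul_right (lintegral_lintegral_enorm_sub_sq_le volume hK hKm hKfin
            (fun x hx y hy => ?_) hw) _
          rw [← ofReal_norm]
          exact ENNReal.ofReal_le_ofReal (hd x hx y hy)
      _ = _ := by
          have h1 : ∫⁻ x in K, ‖fderiv ℝ w x‖ₑ ^ 2 = ENNReal.ofReal D := by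
            rw [hD, ofReal_integral_eq_lintegral_ofReal hDi (.of_forall fun x => by positivity)]
            refine lintegral_congr fun x => ?_
            rw [norm_gradient, ENNReal.ofReal_pow (norm_nonneg _), ofReal_norm]
          rw [h1, finrank_euclideanSpace_fin, ENNReal.ofReal_mul (by positivity),
            ENNReal.ofReal_mul (by positivity), ENNReal.ofReal_mul (by positivity),
            ENNReal.ofReal_mul (by positivity), ENNReal.ofReal_pow hM0, ENNReal.ofReal_pow hd0,
            ENNReal.ofReal_pow zero_le_two, ofReal_measureReal hKfin, ENNReal.ofReal_ofNat]
          ring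
  have hreal : ∫ x, ∫ y, (w x - w y) ^ 2 ∂ν ∂ν
      ≤ 2 ^ n * M ^ 2 * d ^ 2 * volume.real K * D := by
    refine (ENNReal.ofReal_le_ofReal_iff (by positivity)).1 (le_trans ?_ hlin)
    refine (Real.ofReal_le_enorm _).trans ((enorm_integral_le_lintegral_enorm _).trans ?_)
    refine lintegral_mono fun x => (enorm_integral_le_lintegral_enorm _).trans ?_
    refine lintegral_mono fun y => ?_
    simp
  have hQ : ν.real Set.univ = (law q).real K := by simp [hν, measureReal_def]
  rw [hQ] at hvar
  have hmK : m * volume.real K ≤ (law q).real K := by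
    have h := ENNReal.toReal_mono (measure_ne_top (law q) K) (ofReal_mul_volume_le_law hKm hm)
    rwa [ENNReal.toReal_mul, ENNReal.toReal_ofReal hm0.le] at h
  -- Grid pieces may be null or empty; then every integral over `K` against `Q` vanishes.
  rcases (measureReal_nonneg (μ := law q) (s := K)).eq_or_lt with h0 | h0
  · have hz : ν = 0 := Measure.restrict_eq_zero.2
      ((measureReal_eq_zero_iff (measure_ne_top _ _)).1 h0.symm)
    rw [hz]
    simp only [integral_zero_measure]
    positivity
  · have h1 : 2 ^ n * M ^ 2 * d ^ 2 * volume.real K * D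
        ≤ 2 ^ n * M ^ 2 * d ^ 2 * ((law q).real K / m) * D := by
      gcongr
      rw [le_div_iff₀ hm0]
      linarith
    have h2 : (law q).real K * ∫ x, w x ^ 2 ∂ν
        ≤ (law q).real K * (2 ^ n * M ^ 2 / (2 * m) * d ^ 2 * D) + (∫ x, w x ∂ν) ^ 2 := by
      have h3 : (law q).real K * (2 ^ n * M ^ 2 / (2 * m) * d ^ 2 * D)
          = 2 ^ n * M ^ 2 * d ^ 2 * ((law q).real K / m) * D / 2 := by
        field_simp
      linarith
    have h4 := mul_le_mul_of_nonneg_left h2 (inv_nonneg.2 h0.le)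
    rwa [inv_mul_cancel_left₀ h0.ne', mul_add, inv_mul_cancel_left₀ h0.ne'] at h4

end Law

/-! ### Local compactness, tail estimate and total boundedness -/

section LocalAndTail

variable {n : ℕ} {q v : E n → ℝ}

lemma integrable_weighted_gradient_sq (hq : IsC1Density q) (hv : Continuous v) {w : E n → ℝ}
    (hw : ContDiff ℝ 1 w) (hws : HasCompactSupport w) :
    Integrable fun x => Real.exp (v x) ^ 2 * ‖gradient w x‖ ^ 2 * q x := by
  have hcg := continuous_gradient hw
  have hcq := hq.contDiff.continuous
  refine Continuous.integrable_of_hasCompactSupport (by fun_prop) ?_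
  refine HasCompactSupport.mul_right (HasCompactSupport.mul_left ?_)
  exact (hasCompactSupport_gradient hws).comp_left (g := fun z : E n => ‖z‖ ^ 2) (by simp)

lemma integrable_sq_of_hasCompactSupport (μ : Measure (E n)) [IsFiniteMeasureOnCompacts μ]
    {w : E n → ℝ} (hw : Continuous w) (hws : HasCompactSupport w) :
    Integrable (fun x => w x ^ 2) μ := by
  refine Continuous.integrable_of_hasCompactSupport (by fun_prop) ?_
  exact hws.comp_left (g := fun t : ℝ => t ^ 2) (by norm_num)

lemma hasCompactSupport_sub {u w : E n → ℝ} (hu : HasCompactSupport u)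
    (hw : HasCompactSupport w) : HasCompactSupport fun x => u x - w x := by
  have h := hu.add hw.neg
  rwa [← sub_eq_add_neg] at h

/-- On a ball, finitely many averages control the `L²` norm of functions of bounded energy. -/
lemma exists_finset_setIntegral_ball_le (hq : IsC1Density q) (hv : Continuous v)
    {c : ℝ} (hc0 : 0 < c) (hc : ∀ x, c ≤ Real.exp (v x) ^ 2) (R : ℝ) {G : ℝ} (hG : 0 ≤ G)
    {ε : ℝ} (hε : 0 < ε) :
    ∃ (s : Finset (Fin n → ℤ)) (K : (Fin n → ℤ) → Set (E n)), (∀ k, MeasurableSet (K k)) ∧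
      ∀ w : E n → ℝ, ContDiff ℝ 1 w → HasCompactSupport w →
        ∫ x, Real.exp (v x) ^ 2 * ‖gradient w x‖ ^ 2 * q x ≤ G →
        ∫ x in Metric.closedBall 0 R, w x ^ 2 ∂law q
          ≤ ε + ∑ k ∈ s, ((law q).real (K k))⁻¹ * (∫ x in K k, w x ∂law q) ^ 2 := by
  have := hq.isProbabilityMeasure_law
  have hcq := hq.contDiff.continuous
  have hball : IsCompact (Metric.closedBall (0 : E n) R) := isCompact_closedBall _ _
  obtain ⟨m, hm0, hm⟩ : ∃ m, 0 < m ∧ ∀ x ∈ Metric.closedBall (0 : E n) R, m ≤ q x :=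
    hball.exists_forall_le' hcq.continuousOn fun x _ => hq.pos x
  obtain ⟨M, hM⟩ := hball.exists_bound_of_continuousOn hcq.continuousOn
  -- `G / (m * c)` bounds the Dirichlet integral on the ball, so `C * d ^ 2` bounds the total
  -- Poincaré error; the choice `d ^ 2 = ε / (C + 1)` makes this at most `ε`.
  set C : ℝ := 2 ^ n * |M| ^ 2 / (2 * m) * (G / (m * c)) with hC
  have hC0 : 0 ≤ C := by positivity
  obtain ⟨s, K, hconv, hmeas, hdiam, hdisj, hun⟩ :=
    exists_convex_partition n R (d := Real.sqrt (ε / (C + 1))) (by positivity)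
  have hsub : ∀ k ∈ s, K k ⊆ Metric.closedBall 0 R := fun k hk =>
    hun ▸ Set.subset_biUnion_of_mem (u := K) hk
  refine ⟨s, K, hmeas, fun w hw hws hwG => ?_⟩
  have hgi : Integrable (fun x => ‖gradient w x‖ ^ 2) volume := by
    refine (Continuous.integrable_of_hasCompactSupport
      (by have := continuous_gradient hw; fun_prop) ?_)
    exact (hasCompactSupport_gradient hws).comp_left (g := fun z : E n => ‖z‖ ^ 2) (by simp)
  have hdir : ∫ x in Metric.closedBall 0 R, ‖gradient w x‖ ^ 2 ≤ G / (m * c) := by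
    rw [le_div_iff₀ (by positivity), mul_comm, ← integral_const_mul]
    have hgv := integrable_weighted_gradient_sq hq hv hw hws
    refine le_trans (setIntegral_mono_on (hgi.const_mul _).integrableOn hgv.integrableOn
      Metric.isClosed_closedBall.measurableSet fun x hx => ?_)
      ((setIntegral_le_integral hgv (.of_forall fun x => ?_)).trans hwG)
    · have h1 : m * c ≤ q x * Real.exp (v x) ^ 2 :=
        mul_le_mul (hm x hx) (hc x) hc0.le (hq.pos x).le
      nlinarith [mul_le_mul_of_nonneg_right h1 (sq_nonneg ‖gradient w x‖)]
    · have := hq.pos x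
      positivity
  have hsplit : ∀ (μ : Measure (E n)) (f : E n → ℝ), Integrable f μ →
      ∫ x in Metric.closedBall 0 R, f x ∂μ = ∑ k ∈ s, ∫ x in K k, f x ∂μ := fun μ f hf => by
    rw [← hun, integral_biUnion_finset s (fun k _ => hmeas k)
      (fun k _ l _ hkl => hdisj hkl) fun k _ => hf.integrableOn]
  rw [hsplit _ _ (integrable_sq_of_hasCompactSupport (law q) hw.continuous hws)]
  refine (Finset.sum_le_sum fun k hk => setIntegral_law_sq_le hq (hconv k) (hmeas k)
    ((measure_mono (hsub k hk)).trans_lt hball.measure_lt_top).ne hm0 (abs_nonneg M)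
    (Real.sqrt_nonneg _) (fun x hx => hm x (hsub k hk hx))
    (fun x hx => (le_abs_self _).trans ((hM x (hsub k hk hx)).trans (le_abs_self M)))
    (hdiam k) hw hws).trans ?_
  rw [Finset.sum_add_distrib, ← Finset.mul_sum, ← hsplit _ _ hgi, Real.sq_sqrt (by positivity)]
  gcongr
  calc _ ≤ 2 ^ n * |M| ^ 2 / (2 * m) * (ε / (C + 1)) * (G / (m * c)) := by gcongr
    _ = C / (C + 1) * ε := by rw [hC]; ring
    _ ≤ 1 * ε := by gcongr; rw [div_le_one (by positivity)]; linarith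
    _ = ε := one_mul ε

/-- Functions of bounded energy and norm have uniformly small tails. -/
lemma exists_setIntegral_compl_ball_le (hq : IsC1Density q) (hh : ContDiff ℝ 2 (logPotential q))
    (hv : ContDiff ℝ 2 v) (hdiv : Tendsto (tailPotential q v) (cocompact (E n)) atTop)
    {G N : ℝ} (hG : 0 ≤ G) (hN : 0 ≤ N) {ε : ℝ} (hε : 0 < ε) :
    ∃ R : ℝ, ∀ w : E n → ℝ, ContDiff ℝ 1 w → HasCompactSupport w →
      ∫ x, Real.exp (v x) ^ 2 * ‖gradient w x‖ ^ 2 * q x ≤ G → ∫ x, w x ^ 2 ∂law q ≤ N →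
      ∫ x in (Metric.closedBall 0 R)ᶜ, w x ^ 2 ∂law q ≤ ε := by
  have := hq.isProbabilityMeasure_law
  have hcq := hq.contDiff.continuous
  have hcV := continuous_tailPotential hh hv
  -- A continuous function tending to infinity attains its minimum. Adding `B` makes the potential
  -- nonnegative, so a tail integral is bounded by the integral over the whole space.
  obtain ⟨B, hB0, hB⟩ : ∃ B : ℝ, 0 ≤ B ∧ ∀ x, -B ≤ tailPotential q v x := by
    obtain ⟨x₀, hx₀⟩ := hcV.exists_forall_le hdiv
    exact ⟨|tailPotential q v x₀|, abs_nonneg _, fun x => (neg_abs_le _).trans (hx₀ x)⟩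
  -- The summand `1` only ensures `L > 0`.
  set L : ℝ := (G + B * N + 1) / ε with hL
  have hL0 : 0 < L := by positivity
  obtain ⟨R, -, hR⟩ := (Metric.hasBasis_cobounded_compl_closedBall (0 : E n)).mem_iff.1
    (Metric.cobounded_eq_cocompact (α := E n) ▸ hdiv.eventually_ge_atTop L)
  refine ⟨R, fun w hw hws hwG hwN => ?_⟩
  have hcw := hw.continuous
  have hi1 : Integrable fun x => tailPotential q v x * w x ^ 2 * q x := by
    refine Continuous.integrable_of_hasCompactSupport (by fun_prop) ?_
    refine HasCompactSupport.mul_right (HasCompactSupport.mul_left ?_)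
    exact hws.comp_left (g := fun t : ℝ => t ^ 2) (by norm_num)
  have hi2 : Integrable fun x => w x ^ 2 * q x := by
    refine Continuous.integrable_of_hasCompactSupport (by fun_prop) ?_
    exact HasCompactSupport.mul_right (hws.comp_left (g := fun t : ℝ => t ^ 2) (by norm_num))
  have hms : MeasurableSet (Metric.closedBall (0 : E n) R)ᶜ :=
    Metric.isClosed_closedBall.measurableSet.compl
  have hpos : ∀ x, 0 ≤ w x ^ 2 * q x := fun x => mul_nonneg (sq_nonneg _) (hq.pos x).le
  have hsum : Integrable fun x => tailPotential q v x * w x ^ 2 * q x + B * (w x ^ 2 * q x) :=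
    hi1.add (hi2.const_mul B)
  have hkey : L * ∫ x in (Metric.closedBall 0 R)ᶜ, w x ^ 2 ∂law q ≤ G + B * N := by
    rw [setIntegral_law hq hms, ← integral_const_mul]
    calc _ ≤ ∫ x in (Metric.closedBall 0 R)ᶜ,
          (tailPotential q v x * w x ^ 2 * q x + B * (w x ^ 2 * q x)) := by
          refine setIntegral_mono_on (hi2.const_mul L).integrableOn hsum.integrableOn hms
            fun x hx => ?_
          have h1 : L ≤ tailPotential q v x := hR hx
          nlinarith [mul_le_mul_of_nonneg_right h1 (hpos x), mul_nonneg hB0 (hpos x)]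
      _ ≤ ∫ x, (tailPotential q v x * w x ^ 2 * q x + B * (w x ^ 2 * q x)) := by
          refine setIntegral_le_integral hsum (.of_forall fun x => ?_)
          have h1 : 0 ≤ (tailPotential q v x + B) * (w x ^ 2 * q x) :=
            mul_nonneg (by linarith [hB x]) (hpos x)
          simp only [Pi.zero_apply]
          linarith
      _ = (∫ x, tailPotential q v x * w x ^ 2 * q x) + B * ∫ x, w x ^ 2 ∂law q := by
          rw [integral_add hi1 (hi2.const_mul B), integral_const_mul, integral_law hq]
      _ ≤ G + B * N := by
          gcongr
          exact (integral_tailPotential_le hq hh hv hw hws).trans hwG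
  have h2 : L * ε = G + B * N + 1 := by rw [hL]; field_simp
  exact le_of_mul_le_mul_left (by linarith) hL0

lemma norm_sq_eq_integral_law {φ : L2 q} {w : E n → ℝ} (h : φ =ᵐ[law q] w) :
    ‖φ‖ ^ 2 = ∫ x, w x ^ 2 ∂law q := by
  rw [← real_inner_self_eq_norm_sq, L2.inner_def]
  refine integral_congr_ae ?_
  filter_upwards [h] with x hx
  rw [hx, real_inner_self_eq_norm_sq, Real.norm_eq_abs, sq_abs]

/-- Classes of compactly supported `C²` functions with given bounds on energy and norm. -/
def energyBall (q v : E n → ℝ) (G N : ℝ) : Set (L2 q) :=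
  {φ | ‖φ‖ ≤ N ∧ ∃ u : E n → ℝ, ContDiff ℝ 2 u ∧ HasCompactSupport u ∧ φ =ᵐ[law q] u ∧
    ∫ x, Real.exp (v x) ^ 2 * ‖gradient u x‖ ^ 2 * q x ≤ G}

lemma integral_weighted_gradient_sub_sq_le (hq : IsC1Density q) (hv : Continuous v) {G : ℝ}
    {u w : E n → ℝ} (hu : ContDiff ℝ 1 u) (hus : HasCompactSupport u)
    (hw : ContDiff ℝ 1 w) (hws : HasCompactSupport w)
    (huG : ∫ x, Real.exp (v x) ^ 2 * ‖gradient u x‖ ^ 2 * q x ≤ G)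
    (hwG : ∫ x, Real.exp (v x) ^ 2 * ‖gradient w x‖ ^ 2 * q x ≤ G) :
    ∫ x, Real.exp (v x) ^ 2 * ‖gradient (fun y => u y - w y) x‖ ^ 2 * q x ≤ 4 * G := by
  have h1 := integrable_weighted_gradient_sq hq hv hu hus
  have h2 := integrable_weighted_gradient_sq hq hv hw hws
  have h3 := integrable_weighted_gradient_sq hq hv (hu.sub hw)
    (hasCompactSupport_sub hus hws)
  calc _ ≤ ∫ x, (2 * (Real.exp (v x) ^ 2 * ‖gradient u x‖ ^ 2 * q x)
        + 2 * (Real.exp (v x) ^ 2 * ‖gradient w x‖ ^ 2 * q x)) := by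
        refine integral_mono h3 ((h1.const_mul 2).add (h2.const_mul 2)) fun x => ?_
        have h4 : ‖gradient u x - gradient w x‖ ^ 2
            ≤ 2 * ‖gradient u x‖ ^ 2 + 2 * ‖gradient w x‖ ^ 2 := by
          nlinarith [parallelogram_law_with_norm ℝ (gradient u x) (gradient w x),
            norm_nonneg (gradient u x + gradient w x)]
        have h5 : 0 ≤ Real.exp (v x) ^ 2 * q x := mul_nonneg (sq_nonneg _) (hq.pos x).le
        simp only [gradient_sub hu hw]
        nlinarith [mul_le_mul_of_nonneg_left h4 h5]
    _ ≤ 4 * G := by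
        rw [integral_add (h1.const_mul 2) (h2.const_mul 2), integral_const_mul,
          integral_const_mul]
        linarith

/-- The tail and ball estimates are applied to the difference of two members, whose energy is at
most `4 * G` and whose norm is at most `2 * N`. The functionals are inner products with indicators
of the pieces. -/
lemma totallyBounded_energyBall (hq : IsC1Density q) (hh : ContDiff ℝ 2 (logPotential q))
    (hv : ContDiff ℝ 2 v) (hdiv : Tendsto (tailPotential q v) (cocompact (E n)) atTop)
    {c : ℝ} (hc0 : 0 < c) (hc : ∀ x, c ≤ Real.exp (v x) ^ 2) {G : ℝ} (hG : 0 ≤ G) (N : ℝ) :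
    TotallyBounded (energyBall q v G N) := by
  have := hq.isProbabilityMeasure_law
  refine totallyBounded_of_finite_functionals (ι := Fin n → ℤ)
    ((Metric.isBounded_closedBall (x := (0 : L2 q)) (r := N)).subset fun φ hφ => ?_)
    fun ε hε => ?_
  · simpa using hφ.1
  obtain ⟨R, hR⟩ := exists_setIntegral_compl_ball_le hq hh hv hdiv (G := 4 * G)
    (N := (2 * N) ^ 2) (by positivity) (by positivity) (ε := ε ^ 2 / 4) (by positivity)
  obtain ⟨s, K, hK, hloc⟩ := exists_finset_setIntegral_ball_le hq hv.continuous hc0 hc R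
    (G := 4 * G) (by positivity) (ε := ε ^ 2 / 4) (by positivity)
  set A := ∑ k ∈ s, ((law q).real (K k))⁻¹ with hA
  have hA0 : 0 ≤ A := Finset.sum_nonneg fun k _ => by positivity
  refine ⟨s, fun k => innerSL ℝ (indicatorConstLp 2 (hK k) (measure_ne_top (law q) _) (1 : ℝ)),
    -- With this threshold the weighted averages sum to at most `ε ^ 2 / 4`. The tail and the
    -- Poincaré error cost as much each, and `3 * ε ^ 2 / 4 < ε ^ 2`.
    Real.sqrt (ε ^ 2 / 4 / (A + 1)), by positivity, ?_⟩
  rintro φ ⟨hφN, u, hu, hus, hφu, huG⟩ ψ ⟨hψN, w, hw, hws, hψw, hwG⟩ hsmall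
  have hu1 : ContDiff ℝ 1 u := hu.of_le (by norm_num)
  have hw1 : ContDiff ℝ 1 w := hw.of_le (by norm_num)
  have hd : (φ - ψ : L2 q) =ᵐ[law q] fun x => u x - w x := by
    filter_upwards [Lp.coeFn_sub φ ψ, hφu, hψw] with x h1 h2 h3
    rw [h1, Pi.sub_apply, h2, h3]
  have hds := hasCompactSupport_sub hus hws
  have hdG := integral_weighted_gradient_sub_sq_le hq hv.continuous hu1 hus hw1 hws huG hwG
  have hnorm := norm_sq_eq_integral_law hd
  have hN : ‖φ - ψ‖ ^ 2 ≤ (2 * N) ^ 2 := by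
    gcongr
    linarith [norm_sub_le φ ψ]
  have htail := hR _ (hu1.sub hw1) hds hdG (hnorm ▸ hN)
  have hball := hloc _ (hu1.sub hw1) hds hdG
  have hfun : ∀ k ∈ s, (∫ x in K k, (u x - w x) ∂law q) ^ 2 ≤ ε ^ 2 / 4 / (A + 1) := by
    intro k hk
    have h1 := (hsmall k hk).le
    rw [innerSL_apply_apply, L2.inner_indicatorConstLp_one] at h1
    rw [integral_congr_ae (ae_restrict_of_ae hd)] at h1
    rw [← sq_abs, ← Real.sq_sqrt (show 0 ≤ ε ^ 2 / 4 / (A + 1) by positivity)]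
    gcongr
  have hsum : ∑ k ∈ s, ((law q).real (K k))⁻¹ * (∫ x in K k, (u x - w x) ∂law q) ^ 2
      ≤ ε ^ 2 / 4 := by
    calc _ ≤ ∑ k ∈ s, ((law q).real (K k))⁻¹ * (ε ^ 2 / 4 / (A + 1)) :=
          Finset.sum_le_sum fun k hk => by gcongr; exact hfun k hk
      _ = A / (A + 1) * (ε ^ 2 / 4) := by rw [← Finset.sum_mul, ← hA]; ring
      _ ≤ 1 * (ε ^ 2 / 4) := by gcongr; rw [div_le_one (by positivity)]; linarith
      _ = ε ^ 2 / 4 := one_mul _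
  have hadd := integral_add_compl (μ := law q) (s := Metric.closedBall (0 : E n) R)
    Metric.isClosed_closedBall.measurableSet
    (integrable_sq_of_hasCompactSupport (law q) (hu1.sub hw1).continuous hds)
  have : ‖φ - ψ‖ ^ 2 < ε ^ 2 := by
    rw [hnorm, ← hadd]
    nlinarith
  exact lt_of_pow_lt_pow_left₀ 2 hε.le this

end LocalAndTail

/-! ### Weak gradients, the form, and approximation from the core -/

section Form

variable {n : ℕ} {q v : E n → ℝ} {S : E n → Matrix (Fin n) (Fin n) ℝ}

lemma bilin_add_left (M : Matrix (Fin n) (Fin n) ℝ) (a b c : E n) :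
    bilin M (a + b) c = bilin M a c + bilin M b c := by
  simp [bilin, add_dotProduct]

lemma bilin_add_right (M : Matrix (Fin n) (Fin n) ℝ) (a b c : E n) :
    bilin M a (b + c) = bilin M a b + bilin M a c := by
  simp [bilin, Matrix.mulVec_add, dotProduct_add]

lemma bilin_neg_left (M : Matrix (Fin n) (Fin n) ℝ) (a b : E n) :
    bilin M (-a) b = -bilin M a b := by
  simp [bilin]

lemma bilin_neg_right (M : Matrix (Fin n) (Fin n) ℝ) (a b : E n) :
    bilin M a (-b) = -bilin M a b := by
  simp [bilin, Matrix.mulVec_neg]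

lemma bilin_sub_self_le {M : Matrix (Fin n) (Fin n) ℝ} (hM : ∀ a, 0 ≤ bilin M a a) (a b : E n) :
    bilin M (a - b) (a - b) ≤ 2 * bilin M a a + 2 * bilin M b b := by
  have h := hM (a + b)
  simp only [sub_eq_add_neg, bilin_add_left, bilin_add_right, bilin_neg_left,
    bilin_neg_right] at h ⊢
  linarith

lemma TailCriterion.sq_norm_le_bilin (h : TailCriterion q S v) (x a : E n) :
    Real.exp (v x) ^ 2 * ‖a‖ ^ 2 ≤ bilin (S x) a a := by
  have h1 := (h.le_penalty x).dotProduct_mulVec_nonneg a.ofLp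
  have h2 : a.ofLp ⬝ᵥ a.ofLp = ‖a‖ ^ 2 := by
    rw [EuclideanSpace.real_norm_sq_eq]
    simp [dotProduct, sq]
  rw [Matrix.sub_mulVec, Matrix.smul_mulVec, Matrix.one_mulVec, dotProduct_sub, dotProduct_smul,
    star_trivial, h2, smul_eq_mul] at h1
  exact sub_nonneg.1 h1

lemma TailCriterion.bilin_self_nonneg (h : TailCriterion q S v) (x a : E n) :
    0 ≤ bilin (S x) a a :=
  (by positivity : 0 ≤ Real.exp (v x) ^ 2 * ‖a‖ ^ 2).trans (h.sq_norm_le_bilin x a)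

lemma continuous_bilin (hS : IsC1Penalty S) {g : E n → E n} (hg : Continuous g) :
    Continuous fun x => bilin (S x) (g x) (g x) := by
  have h := fun i j => (hS.contDiff i j).continuous
  simp only [bilin, dotProduct, Matrix.mulVec]
  fun_prop

lemma measurable_bilin (hS : IsC1Penalty S) {g : E n → E n} (hg : Measurable g) :
    Measurable fun x => bilin (S x) (g x) (g x) := by
  have h := fun i j => (hS.contDiff i j).continuous.measurable
  simp only [bilin, dotProduct, Matrix.mulVec]
  fun_prop

/-- On a compact set `ρ ≥ m > 0`, so `‖f‖ ≤ 1 + ‖f‖² ≤ 1 + m⁻¹ ‖f‖² ρ`. Applied to `φ` with `ρ = q`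
and to weak gradients with `ρ = ς² q`, it makes the integrals against test functions converge. -/
lemma locallyIntegrable_of_integrable_sq_mul {F : Type*} [NormedAddCommGroup F] {f : E n → F}
    {ρ : E n → ℝ} (hf : AEStronglyMeasurable f volume) (hρ : Continuous ρ) (hρ0 : ∀ x, 0 < ρ x)
    (h : Integrable fun x => ‖f x‖ ^ 2 * ρ x) : LocallyIntegrable f := by
  rw [locallyIntegrable_iff]
  intro K hK
  obtain ⟨m, hm0, hm⟩ : ∃ m, 0 < m ∧ ∀ x ∈ K, m ≤ ρ x :=
    hK.exists_forall_le' hρ.continuousOn fun x _ => hρ0 x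
  have hfin : IntegrableOn (fun _ : E n => (1 : ℝ)) K :=
    integrableOn_const hK.measure_lt_top.ne
  refine Integrable.mono' (hfin.add (h.const_mul m⁻¹).integrableOn) hf.restrict ?_
  refine (ae_restrict_mem hK.measurableSet).mono fun x hx => ?_
  have h1 : ‖f x‖ ^ 2 ≤ m⁻¹ * (‖f x‖ ^ 2 * ρ x) := by
    rw [le_inv_mul_iff₀ hm0, mul_comm]
    exact mul_le_mul_of_nonneg_left (hm x hx) (sq_nonneg _)
  simp only [Pi.add_apply]
  nlinarith [sq_nonneg (‖f x‖ - 1)]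

lemma locallyIntegrable_L2 (hq : IsC1Density q) (φ : L2 q) : LocallyIntegrable φ := by
  have hm : AEStronglyMeasurable φ volume :=
    (Lp.aestronglyMeasurable φ).mono_ac hq.volume_absolutelyContinuous
  refine locallyIntegrable_of_integrable_sq_mul hm hq.contDiff.continuous hq.pos ?_
  have h1 := (integrable_withDensity_iff hq.measurable_ofReal
    (.of_forall fun x => ENNReal.ofReal_lt_top)).1 (Lp.memLp φ).integrable_sq
  refine h1.congr (.of_forall fun x => ?_)
  simp [ENNReal.toReal_ofReal (hq.pos x).le]

lemma IsWeakGradient.locallyIntegrable (hq : IsC1Density q) (hcrit : TailCriterion q S v)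
    {φ : L2 q} {g : E n → E n} (h : IsWeakGradient q S φ g) : LocallyIntegrable g := by
  have hcq := hq.contDiff.continuous
  have hcv := hcrit.contDiff.continuous
  have hgm := h.measurable
  refine locallyIntegrable_of_integrable_sq_mul (ρ := fun x => Real.exp (v x) ^ 2 * q x)
    hgm.aestronglyMeasurable (by fun_prop)
    (fun x => mul_pos (by positivity) (hq.pos x)) ?_
  refine h.energy_finite.mono' (Measurable.aestronglyMeasurable (by fun_prop))
    (.of_forall fun x => ?_)
  have hqx := (hq.pos x).le
  rw [Real.norm_of_nonneg (by positivity)]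
  calc _ = Real.exp (v x) ^ 2 * ‖g x‖ ^ 2 * q x := by ring
    _ ≤ _ := mul_le_mul_of_nonneg_right (hcrit.sq_norm_le_bilin x (g x)) hqx

lemma IsWeakGradient.ae_eq (hq : IsC1Density q) (hcrit : TailCriterion q S v)
    {φ : L2 q} {g₁ g₂ : E n → E n} (h₁ : IsWeakGradient q S φ g₁)
    (h₂ : IsWeakGradient q S φ g₂) : g₁ =ᵐ[volume] g₂ := by
  refine ae_eq_of_integral_contDiff_smul_eq (h₁.locallyIntegrable hq hcrit)
    (h₂.locallyIntegrable hq hcrit) fun ψ hψ hψs => ?_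
  have hψ1 : ContDiff ℝ 1 ψ := hψ.of_le (by exact_mod_cast le_top)
  rw [← neg_inj, ← h₁.integral_eq ψ hψ1 hψs, ← h₂.integral_eq ψ hψ1 hψs]

lemma IsWeakGradient.sub (hq : IsC1Density q) (hS : IsC1Penalty S) (hcrit : TailCriterion q S v)
    {φ₁ φ₂ : L2 q} {g₁ g₂ : E n → E n} (h₁ : IsWeakGradient q S φ₁ g₁)
    (h₂ : IsWeakGradient q S φ₂ g₂) : IsWeakGradient q S (φ₁ - φ₂) fun x => g₁ x - g₂ x where
  measurable := h₁.measurable.sub h₂.measurable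
  energy_finite := by
    have hcq := hq.contDiff.continuous.measurable
    have hm := measurable_bilin hS (h₁.measurable.sub h₂.measurable)
    refine ((h₁.energy_finite.const_mul 2).add (h₂.energy_finite.const_mul 2)).mono'
      (hm.mul hcq).aestronglyMeasurable (.of_forall fun x => ?_)
    have h3 := bilin_sub_self_le (hcrit.bilin_self_nonneg x) (g₁ x) (g₂ x)
    have hqx := (hq.pos x).le
    rw [Real.norm_of_nonneg (mul_nonneg (hcrit.bilin_self_nonneg _ _) hqx)]
    simp only [Pi.add_apply]
    nlinarith [mul_le_mul_of_nonneg_right h3 hqx]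
  integral_eq ψ hψ hψs := by
    have hgc := continuous_gradient hψ
    have hgs := hasCompactSupport_gradient hψs
    have hae : ∀ᵐ x, (φ₁ - φ₂ : L2 q) x • gradient ψ x
        = φ₁ x • gradient ψ x - φ₂ x • gradient ψ x := by
      filter_upwards [hq.volume_absolutelyContinuous.ae_eq (Lp.coeFn_sub φ₁ φ₂)] with x hx
      rw [hx, Pi.sub_apply, sub_smul]
    rw [integral_congr_ae hae, integral_sub
      ((locallyIntegrable_L2 hq φ₁).integrable_smul_right_of_hasCompactSupport hgc hgs)
      ((locallyIntegrable_L2 hq φ₂).integrable_smul_right_of_hasCompactSupport hgc hgs),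
      h₁.integral_eq ψ hψ hψs, h₂.integral_eq ψ hψ hψs]
    simp_rw [smul_sub]
    rw [integral_sub ((h₁.locallyIntegrable hq
        hcrit).integrable_smul_left_of_hasCompactSupport hψ.continuous hψs)
      ((h₂.locallyIntegrable hq
        hcrit).integrable_smul_left_of_hasCompactSupport hψ.continuous hψs)]
    abel

lemma integral_smul_gradient_eq_neg {u ψ : E n → ℝ} (hu : ContDiff ℝ 1 u)
    (hus : HasCompactSupport u) (hψ : ContDiff ℝ 1 ψ) (hψs : HasCompactSupport ψ) :
    ∫ x, u x • gradient ψ x = -∫ x, ψ x • gradient u x := by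
  have hcu := hu.continuous
  have hcψ := hψ.continuous
  have hcgu := continuous_gradient hu
  have hcgψ := continuous_gradient hψ
  have hi1 : Integrable fun x => u x • gradient ψ x :=
    Continuous.integrable_of_hasCompactSupport (by fun_prop) hus.smul_right
  have hi2 : Integrable fun x => ψ x • gradient u x :=
    Continuous.integrable_of_hasCompactSupport (by fun_prop) hψs.smul_right
  ext i
  have h1 := (EuclideanSpace.proj i : E n →L[ℝ] ℝ).integral_comp_comm hi1
  have h2 := (EuclideanSpace.proj i : E n →L[ℝ] ℝ).integral_comp_comm hi2
  simp only [PiLp.proj_apply, PiLp.smul_apply, gradient_apply, smul_eq_mul] at h1 h2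
  rw [PiLp.neg_apply, ← h1, ← h2]
  have hdu : Continuous fun x => fderiv ℝ u x (EuclideanSpace.single i 1) :=
    (hu.continuous_fderiv one_ne_zero).clm_apply continuous_const
  have hdψ : Continuous fun x => fderiv ℝ ψ x (EuclideanSpace.single i 1) :=
    (hψ.continuous_fderiv one_ne_zero).clm_apply continuous_const
  rw [integral_mul_fderiv_eq_neg_fderiv_mul_of_integrable
    ((hdu.mul hcψ).integrable_of_hasCompactSupport hψs.mul_left)
    ((hcu.mul hdψ).integrable_of_hasCompactSupport hus.mul_right)
    ((hcu.mul hcψ).integrable_of_hasCompactSupport hus.mul_right)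
    (fun x _ => (hu.differentiable one_ne_zero) x) (fun x _ => (hψ.differentiable one_ne_zero) x)]
  simp_rw [mul_comm]

lemma isWeakGradient_gradient (hq : IsC1Density q) (hS : IsC1Penalty S) {φ : L2 q} {u : E n → ℝ}
    (hu : ContDiff ℝ 1 u) (hus : HasCompactSupport u) (hφ : φ =ᵐ[law q] u) :
    IsWeakGradient q S φ (gradient u) where
  measurable := (continuous_gradient hu).measurable
  energy_finite := by
    have hcq := hq.contDiff.continuous
    have hcb := continuous_bilin hS (continuous_gradient hu)
    refine Continuous.integrable_of_hasCompactSupport (by fun_prop) ?_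
    refine HasCompactSupport.mul_right ?_
    refine (hasCompactSupport_gradient hus).mono fun x hx => ?_
    contrapose! hx
    simp only [Function.mem_support, not_not] at hx ⊢
    simp [hx, bilin]
  integral_eq ψ hψ hψs := by
    rw [← integral_smul_gradient_eq_neg hu hus hψ hψs]
    refine integral_congr_ae ?_
    filter_upwards [hq.volume_absolutelyContinuous.ae_eq hφ] with x hx
    rw [hx]

lemma isWeakGradient_weakGradient {φ : L2 q} (h : φ ∈ formDomain q S) :
    IsWeakGradient q S φ (weakGradient q S φ) := by
  have h' : ∃ g, IsWeakGradient q S φ g := h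
  rw [weakGradient, dif_pos h']
  exact h'.choose_spec

/-- Weak gradients are unique almost everywhere, so the arbitrary choice made in `weakGradient` is
immaterial and a classical gradient may be used instead. -/
lemma form_self_eq (hq : IsC1Density q) (hcrit : TailCriterion q S v) {φ : L2 q}
    {g : E n → E n} (h : IsWeakGradient q S φ g) :
    form q S φ φ = 1 / 2 * ∫ x, bilin (S x) (g x) (g x) * q x := by
  rw [form]
  congr 1
  refine integral_congr_ae ?_
  filter_upwards [(isWeakGradient_weakGradient ⟨g, h⟩).ae_eq hq hcrit h] with x hx
  rw [hx]

lemma form_self_nonneg (hq : IsC1Density q) (hcrit : TailCriterion q S v) (φ : L2 q) :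
    0 ≤ form q S φ φ :=
  mul_nonneg (by norm_num) (integral_nonneg fun x =>
    mul_nonneg (hcrit.bilin_self_nonneg _ _) (hq.pos x).le)

lemma form_self_le (hq : IsC1Density q) (hS : IsC1Penalty S) (hcrit : TailCriterion q S v)
    {φ ψ : L2 q} (hφ : φ ∈ formDomain q S) (hψ : ψ ∈ formDomain q S) :
    form q S φ φ ≤ 2 * form q S ψ ψ + 2 * form q S (φ - ψ) (φ - ψ) := by
  obtain ⟨g, hg⟩ := hφ
  obtain ⟨k, hk⟩ := hψ
  have hgk := hg.sub hq hS hcrit hk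
  rw [form_self_eq hq hcrit hg, form_self_eq hq hcrit hk, form_self_eq hq hcrit hgk]
  have h : ∫ x, bilin (S x) (g x) (g x) * q x
      ≤ ∫ x, (2 * (bilin (S x) (k x) (k x) * q x)
        + 2 * (bilin (S x) (g x - k x) (g x - k x) * q x)) := by
    refine integral_mono hg.energy_finite
      ((hk.energy_finite.const_mul 2).add (hgk.energy_finite.const_mul 2)) fun x => ?_
    -- Uses `g = (g - k) - (-k)`.
    have h1 := bilin_sub_self_le (hcrit.bilin_self_nonneg x) (g x - k x) (-k x)
    rw [sub_neg_eq_add, sub_add_cancel, bilin_neg_left, bilin_neg_right, neg_neg] at h1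
    have := mul_le_mul_of_nonneg_right h1 (hq.pos x).le
    simp only
    linarith
  rw [integral_add (hk.energy_finite.const_mul 2) (hgk.energy_finite.const_mul 2),
    integral_const_mul, integral_const_mul] at h
  linarith

lemma integral_weighted_gradient_sq_le_form (hq : IsC1Density q) (hS : IsC1Penalty S)
    (hcrit : TailCriterion q S v) {φ : L2 q} {u : E n → ℝ} (hu : ContDiff ℝ 1 u)
    (hus : HasCompactSupport u) (hφ : φ =ᵐ[law q] u) :
    ∫ x, Real.exp (v x) ^ 2 * ‖gradient u x‖ ^ 2 * q x ≤ 2 * form q S φ φ := by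
  have h := isWeakGradient_gradient hq hS hu hus hφ
  rw [form_self_eq hq hcrit h, ← mul_assoc, mul_one_div_cancel two_ne_zero, one_mul]
  exact integral_mono
    (integrable_weighted_gradient_sq hq hcrit.contDiff.continuous hu hus) h.energy_finite
    fun x => mul_le_mul_of_nonneg_right (hcrit.sq_norm_le_bilin x _) (hq.pos x).le

lemma sublevel_subset_closure_energyBall (hq : IsC1Density q) (hS : IsC1Penalty S)
    (hcore : IsCore q S (CK2 q)) (hcrit : TailCriterion q S v) {θ : ℝ} (hθ : 0 < θ) :
    {φ : L2 q | φ ∈ formDomain q S ∧ form q S φ φ + θ * inner ℝ φ φ ≤ 1}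
      ⊆ closure (energyBall q v 8 (Real.sqrt θ⁻¹ + 1)) := by
  rintro φ₀ ⟨hφ₀, hle⟩
  rw [real_inner_self_eq_norm_sq] at hle
  have hform₀ := form_self_nonneg hq hcrit φ₀
  have hform₁ : form q S φ₀ φ₀ ≤ 1 := by nlinarith [mul_nonneg hθ.le (sq_nonneg ‖φ₀‖)]
  have hnorm₀ : ‖φ₀‖ ≤ Real.sqrt θ⁻¹ := by
    refine Real.le_sqrt_of_sq_le ?_
    rw [← one_div, le_div_iff₀ hθ]
    linarith
  obtain ⟨φ, hφ, hlim⟩ := hcore.2 φ₀ hφ₀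
  rw [Metric.mem_closure_iff]
  intro ε hε
  -- The bound `ε ^ 2` gives the distance. The bound `1` gives norm at most `√θ⁻¹ + 1` and form at
  -- most `2 * 1 + 2 * 1 = 4`; the weighted gradient integral is at most twice the form, hence the
  -- `8`.
  obtain ⟨j, hj⟩ := (hlim.eventually_lt_const
    (show (0 : ℝ) < min (ε ^ 2) 1 by positivity)).exists
  rw [real_inner_self_eq_norm_sq] at hj
  have hform := form_self_nonneg hq hcrit (φ j - φ₀)
  have hj1 := hj.trans_le (min_le_left _ _)
  have hj2 := hj.trans_le (min_le_right _ _)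
  obtain ⟨u, hu, hus, hφu⟩ := hφ j
  refine ⟨φ j, ⟨?_, u, hu, hus, hφu, ?_⟩, ?_⟩
  · have h1 : ‖φ j - φ₀‖ ≤ 1 :=
      (sq_le_one_iff₀ (norm_nonneg _)).1 (by linarith)
    linarith [norm_le_norm_add_norm_sub' (φ j) φ₀]
  · have h1 := form_self_le hq hS hcrit (hcore.1 (hφ j)) hφ₀
    have h2 := integral_weighted_gradient_sq_le_form hq hS hcrit
      (hu.of_le (m := 1) (by norm_num)) hus hφu
    nlinarith [sq_nonneg ‖φ j - φ₀‖]
  · rw [dist_comm, dist_eq_norm]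
    exact lt_of_pow_lt_pow_left₀ 2 hε.le (by linarith)

end Form

end NPC

end

theorem mainTheorem3 {n : ℕ} (q : NPC.E n → ℝ) (S : NPC.E n → Matrix (Fin n) (Fin n) ℝ)
    (v : NPC.E n → ℝ) (hq : NPC.IsC1Density q) (hS : NPC.IsC1Penalty S)
    (hh : ContDiff ℝ 2 (NPC.logPotential q))
    (hcore : NPC.IsCore q S (NPC.CK2 q))
    (hcrit : NPC.TailCriterion q S v) :
    ∀ θ : ℝ, 0 < θ → NPC.ExistenceCondition q S θ := by
  intro θ hθ
  obtain ⟨c, hc0, hc⟩ := hcrit.lower_bound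
  -- The function in `tail_diverge` is `tailPotential q v` by definition.
  have hT := NPC.totallyBounded_energyBall hq hh hcrit.contDiff hcrit.tail_diverge hc0 hc
    (G := 8) (by norm_num) (Real.sqrt θ⁻¹ + 1)
  exact (hT.closure.isCompact_of_isClosed isClosed_closure).of_isClosed_subset
    isClosed_closure (closure_minimal
      (NPC.sublevel_subset_closure_energyBall hq hS hcore hcrit hθ) isClosed_closure)
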